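/- Let $R$ be a (commutative) Dedekind domain with quotient field $K$, and let $G$ be a finite group acting on $R$ by ring automorphisms $\sigma_g$, extended to $K$; write $R^G$ for the ring of invariants. Let $A = K\diamondsuit_{\sigma,\alpha} G$ be a crystalline graded ring: a ring containing $K$ as a subring with the same identity, with elements $u_g$ ($g\in G$), $u_e = 1$, such that $A=\bigoplus_{g\in G} K u_g$ with each $u_g$ a left $K$-basis of $Ku_g$, and such that $u_g k = \sigma_g(k)u_g$ and $u_g u_h=\alpha(g,h)u_{gh}$ for all $k\in K$ and $g,h\in G$, where $\alpha(g,h)\in K\setminus\{0\}$. ($K$ need not be central in $A$.) An $R$-lattice in $A$ is an $R$-torsionfree $R$-sub-bimodule $M\subset A$, on which the left and right actions of $R^G$ coincide, that is finitely generated as a left and as a right $R$-module; it is full if $KM=A=MK$. A subset $T\subset A$ is graded if $\sum_{g} x_g u_g\in T$ (with $x_g\in K$) implies $x_g u_g\in T$ for all $g \in G$. A gr-order in $A$ is a subring of $A$ with the same identity element that is a graded full $R$-lattice in $A$; a gr-maximal order is a gr-order that is maximal, with respect to inclusion, among the gr-orders in $A$. For a full $R$-lattice $M$ in $A$ put $O_l(M)=\{x\in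 A : xM\subset M\}$ and $O_r(M)=\{x\in A : Mx\subset M\}$. Theorem. Let $M$ be a full graded $R$-lattice in $A$. Then $O_l(M)$ is a gr-maximal order if and only if $O_r(M)$ is a gr-maximal order. -/

import Mathlib

/-- The extension `σ_g : K ≃+* K` to the quotient field `K` of `R` of the automorphism
`r ↦ g • r` of `R`. -/
noncomputable def fracAut (R K : Type*) {G : Type*} [CommRing R] [Field K] [Algebra R K]
    [IsFractionRing R K] [Group G] [MulSemiringAction G R] (g : G) : K ≃+* K :=
  IsFractionRing.ringEquivOfRingEquiv (MulSemiringAction.toRingEquiv G R g)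

/-- A presentation of the ring `A` as a crystalline graded ring `K ◇_{σ,α} G`, where `G` is a
finite group acting on `R` by ring automorphisms and `σ` is the induced action on the quotient
field `K` of `R`. Neither `K` nor `R` need be central in `A`. -/
structure CrystallineGraded (R K G A : Type*) [CommRing R] [Field K] [Algebra R K]
    [IsFractionRing R K] [Group G] [Fintype G] [MulSemiringAction G R] [Ring A] where
  /-- the inclusion `K ⊂ A` (with `1_K = 1_A`) -/
  incl : K →+* A
  /-- the homogeneous basis elements `u_g` -/
  u : G → A
  /-- the structure constants `α(g,h)` -/
  α : G → G → K
  u_one : u 1 = 1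
  /-- `A = ⊕_g K u_g`, and every `K u_g` is a free left `K`-module with basis `u_g` -/
  existsUnique_coeff : ∀ a : A, ∃! c : G → K, a = ∑ g, incl (c g) * u g
  /-- `u_g k = σ_g(k) u_g`, so that `K u_g = u_g K` -/
  u_mul_incl : ∀ (g : G) (k : K), u g * incl k = incl (fracAut R K g k) * u g
  /-- `u_g u_h = α(g,h) u_{gh}`, so that `A` is `G`-graded with `A_g = K u_g` -/
  u_mul_u : ∀ g h : G, u g * u h = incl (α g h) * u (g * h)
  /-- torsion-freeness: no `α(g,h)` is a zero divisor of the field `K` -/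
  α_ne_zero : ∀ g h : G, α g h ≠ 0

namespace CrystallineGraded

variable {R K G A : Type*} [CommRing R] [Field K] [Algebra R K] [IsFractionRing R K]
  [Group G] [Fintype G] [MulSemiringAction G R] [Ring A]

/-- The inclusion `R ⊂ K ⊂ A`. -/
def inclR (C : CrystallineGraded R K G A) : R →+* A :=
  C.incl.comp (algebraMap R K)

/-- For a ring `B` mapped to `A` by `f` and `S ⊂ A`: the additive subgroup `BS` of all finite
sums of elements `b s`. -/
def leftSpan {B : Type*} [Semiring B] (f : B →+* A) (S : Set A) : AddSubgroup A :=
  AddSubgroup.closure {x | ∃ b : B, ∃ s ∈ S, x = f b * s}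

/-- For a ring `B` mapped to `A` by `f` and `S ⊂ A`: the additive subgroup `SB` of all finite
sums of elements `s b`. -/
def rightSpan {B : Type*} [Semiring B] (f : B →+* A) (S : Set A) : AddSubgroup A :=
  AddSubgroup.closure {x | ∃ b : B, ∃ s ∈ S, x = s * f b}

/-- `M` is an `R`-lattice in `A`: an `R`-torsionfree `R`-bimodule over `R^G` inside `A` that is
finitely generated both as a left and as a right `R`-module. -/
structure IsLattice (C : CrystallineGraded R K G A) (M : AddSubgroup A) : Prop where
  mul_left_mem : ∀ (r : R), ∀ m ∈ M, C.inclR r * m ∈ M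
  mul_right_mem : ∀ (r : R), ∀ m ∈ M, m * C.inclR r ∈ M
  /-- the left and right actions of the invariant ring `R^G` on `M` agree -/
  invariant_comm : ∀ a : R, (∀ g : G, g • a = a) → ∀ m ∈ M, C.inclR a * m = m * C.inclR a
  torsionfree_left : ∀ (r : R), ∀ m ∈ M, C.inclR r * m = 0 → r = 0 ∨ m = 0
  torsionfree_right : ∀ (r : R), ∀ m ∈ M, m * C.inclR r = 0 → r = 0 ∨ m = 0
  fg_left : ∃ S : Finset A, leftSpan C.inclR (S : Set A) = M
  fg_right : ∃ S : Finset A, rightSpan C.inclR (S : Set A) = M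

/-- `M` is a full `R`-lattice in `A`: an `R`-lattice with `KM = A = MK`. -/
structure IsFullLattice (C : CrystallineGraded R K G A) (M : AddSubgroup A) : Prop
    extends C.IsLattice M where
  left_full : leftSpan C.incl (M : Set A) = ⊤
  right_full : rightSpan C.incl (M : Set A) = ⊤

/-- `T ⊂ A` is graded: with `x = ∑ x_g u_g` it contains every component `x_g u_g`. -/
def IsGraded (C : CrystallineGraded R K G A) (T : Set A) : Prop :=
  ∀ c : G → K, ∑ g, C.incl (c g) * C.u g ∈ T → ∀ g, C.incl (c g) * C.u g ∈ T

/-- A gr-order in `A`: a subring (with the same identity element) that is a graded full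
`R`-lattice. -/
structure IsGrOrder (C : CrystallineGraded R K G A) (Λ : Subring A) : Prop where
  isFullLattice : C.IsFullLattice Λ.toAddSubgroup
  isGraded : C.IsGraded (Λ : Set A)

/-- A gr-maximal order in `A`: a gr-order that is maximal among the gr-orders in `A`. -/
def IsGrMaximalOrder (C : CrystallineGraded R K G A) (Λ : Subring A) : Prop :=
  Maximal C.IsGrOrder Λ

end CrystallineGraded

/-- The left order `O_l(M) = {x ∈ A | xM ⊂ M}`. -/
def leftOrder {A : Type*} [Ring A] (M : AddSubgroup A) : Subring A where
  carrier := {x | ∀ m ∈ M, x * m ∈ M}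
  mul_mem' {x y} hx hy m hm := by rw [mul_assoc]; exact hx _ (hy _ hm)
  one_mem' m hm := by rwa [one_mul]
  add_mem' {x y} hx hy m hm := by rw [add_mul]; exact M.add_mem (hx _ hm) (hy _ hm)
  zero_mem' m _ := by rw [zero_mul]; exact M.zero_mem
  neg_mem' {x} hx m hm := by rw [neg_mul]; exact M.neg_mem (hx _ hm)

/-- The right order `O_r(M) = {x ∈ A | Mx ⊂ M}`. -/
def rightOrder {A : Type*} [Ring A] (M : AddSubgroup A) : Subring A where
  carrier := {x | ∀ m ∈ M, m * x ∈ M}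
  mul_mem' {x y} hx hy m hm := by rw [← mul_assoc]; exact hy _ (hx _ hm)
  one_mem' m hm := by rwa [mul_one]
  add_mem' {x y} hx hy m hm := by rw [mul_add]; exact M.add_mem (hx _ hm) (hy _ hm)
  zero_mem' m _ := by rw [mul_zero]; exact M.zero_mem
  neg_mem' {x} hx m hm := by rw [mul_neg]; exact M.neg_mem (hx _ hm)

/-!
Write `M = ⊕ J_g u_g` with fractional ideals `J_g ≠ 0`. For a maximal ideal `Q` the number
`|G| v_{gQ}(J_g) + w(g, Q)`, where `w(g, Q) = ∑_k v_{gQ}(α(g, k))`, is the level of `M` on the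
arrow `Q ⟶ gQ` of the action groupoid. The cocycle identity for `α` makes levels additive under
multiplication, so that `w` is a `1`-cocycle modulo `|G|`, gr-orders become the finitely supported
subadditive functions on arrows that are congruent to `w` and at most `0` on identities, and the
levels of `O_l(M)` and `O_r(M)` are the left and right residuals of the level of `M`.

A gr-order is maximal if and only if its level is, up to rounding modulo `|G|`, the difference
`p(gQ) - p(Q)` of a potential `p`: finiteness of `G` provides a potential below any order level,
by taking a cheapest arrow from a base point of each orbit. If the level of `O_l(M)` has this form
for `p`, then the level of `M` is the rounded difference `p(gQ) - q(Q)` for a second function `q`,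
and hence the level of `O_r(M)` is the rounded difference `q(gQ) - q(Q)`. The converse is the same
argument with all arrows reversed.
-/

section ActionGroupoid

variable {G S : Type*} [Group G] [MulAction G S] {n : ℤ} {w m c : G → S → ℤ} {p q : S → ℤ}

/-- The class of `w` modulo `n` is a `1`-cocycle on the action groupoid of `G` on `S`, whose
arrows `Q ⟶ g • Q` are encoded as pairs `(g, Q)`. -/
def IsCocycleMod (n : ℤ) (w : G → S → ℤ) : Prop :=
  ∀ g h Q, w (g * h) Q ≡ w g (h • Q) + w h Q [ZMOD n]

/-- The functions on arrows that occur as levels of gr-orders: those in a prescribed class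
`w` modulo `n` that are subadditive under composition and at most `0` on identities. -/
structure IsOrderLevel (n : ℤ) (w c : G → S → ℤ) : Prop where
  modEq : ∀ g Q, c g Q ≡ w g Q [ZMOD n]
  mul_le : ∀ g h Q, c (g * h) Q ≤ c g (h • Q) + c h Q
  one_le : ∀ Q, c 1 Q ≤ 0

/-- Up to rounding within a class modulo `n`, the function `m` on arrows is the difference of
the potentials `p` at the target and `q` at the source, and between any two points of an orbit
it is exactly this difference for some arrow. -/
structure IsPotentialPair (n : ℤ) (m : G → S → ℤ) (p q : S → ℤ) : Prop where
  le : ∀ (g : G) Q, p (g • Q) - q Q ≤ m g Q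
  lt : ∀ (g : G) Q, m g Q < p (g • Q) - q Q + n
  exists_eq : ∀ (h : G) Q, ∃ g : G, g • Q = h • Q ∧ m g Q = p (h • Q) - q Q

theorem hasFiniteSupport_comp_smul {f : S → ℤ} (hf : f.HasFiniteSupport) (g : G) :
    (fun Q => f (g • Q)).HasFiniteSupport :=
  (MulAction.injective g).tendsto_cofinite.eventually hf

theorem le_of_intModEq_of_lt_add {a b c n : ℤ} (hab : a ≡ b [ZMOD n]) (hac : a < c + n)
    (hcb : c ≤ b) : a ≤ b := by
  by_contra! hba
  have hdvd : n ∣ a - b := hab.symm.dvd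
  have := Int.le_of_dvd (sub_pos.2 hba) hdvd
  linarith

theorem IsCocycleMod.one (hw : IsCocycleMod n w) (Q : S) : w 1 Q ≡ 0 [ZMOD n] := by
  have := hw 1 1 Q
  rw [mul_one, one_smul] at this
  simpa using (this.sub_right (w 1 Q)).symm

theorem IsCocycleMod.congr (hw : IsCocycleMod n w) (hm : ∀ g Q, m g Q ≡ w g Q [ZMOD n]) :
    IsCocycleMod n m := fun g h Q =>
  (hm _ Q).trans ((hw g h Q).trans ((hm g _).add (hm h Q)).symm)

theorem IsPotentialPair.of_modEq (le : ∀ (g : G) Q, p (g • Q) - q Q ≤ m g Q)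
    (lt : ∀ (g : G) Q, m g Q < p (g • Q) - q Q + n)
    (exists_modEq : ∀ (h : G) Q, ∃ g : G, g • Q = h • Q ∧ m g Q ≡ p (h • Q) - q Q [ZMOD n]) :
    IsPotentialPair n m p q where
  le := le
  lt := lt
  exists_eq h Q := by
    obtain ⟨g, hgQ, hg⟩ := exists_modEq h Q
    rw [← hgQ] at hg ⊢
    exact ⟨g, rfl, (le_of_intModEq_of_lt_add hg (lt g Q) le_rfl).antisymm (le g Q)⟩

theorem IsOrderLevel.one_nonneg (hc : IsOrderLevel n w c) (Q : S) : 0 ≤ c 1 Q := by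
  have := hc.mul_le 1 1 Q
  rw [mul_one, one_smul] at this
  linarith

theorem IsOrderLevel.neg_inv_le (hc : IsOrderLevel n w c) (g : G) (Q : S) :
    -c g⁻¹ (g • Q) ≤ c g Q := by
  have := hc.mul_le g⁻¹ g Q
  rw [inv_mul_cancel] at this
  linarith [hc.one_nonneg Q]

theorem IsOrderLevel.hasFiniteSupport_of_le (hc : IsOrderLevel n w c) (hcm : c ≤ m)
    (hm : ∀ g, (m g).HasFiniteSupport) (g : G) : (c g).HasFiniteSupport := by
  refine ((hasFiniteSupport_comp_smul (hm g⁻¹) g).union (hm g)).subset fun Q hQ => ?_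
  by_contra h
  simp only [Set.mem_union, Function.mem_support, not_or, not_not] at h
  exact hQ (by linarith [hc.neg_inv_le g Q, hcm g Q, hcm g⁻¹ (g • Q)])

theorem IsOrderLevel.pow_le_nsmul (hc : IsOrderLevel n w c) {s : G} {Q : S} (hs : s • Q = Q)
    (k : ℕ) : c (s ^ k) Q ≤ k * c s Q := by
  induction k with
  | zero => simpa using hc.one_le Q
  | succ k ih =>
    have := hc.mul_le (s ^ k) s Q
    rw [hs, ← pow_succ] at this
    push_cast
    linarith

theorem IsOrderLevel.nonneg_of_smul_eq [Finite G] (hc : IsOrderLevel n w c) {s : G} {Q : S}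
    (hs : s • Q = Q) : 0 ≤ c s Q := by
  have := hc.pow_le_nsmul hs (Nat.card G)
  rw [pow_card_eq_one'] at this
  have hpos : (0 : ℤ) < Nat.card G := by exact_mod_cast Nat.card_pos
  exact nonneg_of_mul_nonneg_right ((hc.one_nonneg Q).trans this) hpos

variable (G S) in
theorem exists_orbit_representatives :
    ∃ base : S → S, (∀ (g : G) Q, base (g • Q) = base Q) ∧ ∀ Q, ∃ g : G, g • base Q = Q := by
  let orbits := MulAction.orbitRel G S
  refine ⟨fun Q => (⟦Q⟧ : Quotient orbits).out, fun g Q => ?_, fun Q => ?_⟩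
  · exact congrArg Quotient.out (Quotient.sound ⟨g, rfl⟩)
  · exact Setoid.symm (Quotient.mk_out Q)

theorem IsOrderLevel.exists_potential [Finite G] (hc : IsOrderLevel n w c)
    (hw : IsCocycleMod n w) :
    ∃ p : S → ℤ, (∀ (g : G) Q, p (g • Q) - p Q ≤ c g Q) ∧
      ∀ (h : G) Q, ∃ g : G, g • Q = h • Q ∧ w g Q ≡ p (h • Q) - p Q [ZMOD n] := by
  obtain ⟨base, base_smul, exists_smul_base⟩ := exists_orbit_representatives G S
  have exists_least (Q : S) : ∃ t : G, t • base Q = Q ∧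
      ∀ h : G, h • base Q = Q → c t (base Q) ≤ c h (base Q) :=
    Set.exists_min_image {h : G | h • base Q = Q} (c · (base Q)) (Set.toFinite _)
      (exists_smul_base Q)
  choose t ht hmin using exists_least
  refine ⟨fun Q => c (t Q) (base Q), fun g Q => ?_, fun h Q => ⟨t (h • Q) * (t Q)⁻¹, ?_, ?_⟩⟩
  · have hle := hmin (g • Q) (g * t Q) (by rw [base_smul, mul_smul, ht])
    have hadd := hc.mul_le g (t Q) (base Q)
    rw [ht] at hadd
    rw [base_smul] at hle
    simp only [base_smul]
    linarith
  · have h1 := ht (h • Q)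
    rw [base_smul] at h1
    rw [mul_smul, inv_smul_eq_iff.2 (ht Q).symm, h1]
  · have hmul := hw (t (h • Q) * (t Q)⁻¹) (t Q) (base Q)
    rw [inv_mul_cancel_right, ht] at hmul
    simp only [base_smul]
    have := ((hc.modEq _ _).trans hmul).sub (hc.modEq (t Q) (base Q))
    rw [add_sub_cancel_right] at this
    exact this.symm

/-- The least function in the class of `w` modulo `n` that bounds from above the differences
of the potential `p`. -/
def roundUp (n : ℤ) (w : G → S → ℤ) (p : S → ℤ) (g : G) (Q : S) : ℤ :=
  p (g • Q) - p Q + (w g Q - (p (g • Q) - p Q)) % n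

theorem roundUp_modEq (g : G) (Q : S) : roundUp n w p g Q ≡ w g Q [ZMOD n] := by
  simpa [roundUp] using ((Int.mod_modEq (w g Q - (p (g • Q) - p Q)) n).add_left (p (g • Q) - p Q))

theorem le_roundUp (hn : 0 < n) (g : G) (Q : S) : p (g • Q) - p Q ≤ roundUp n w p g Q :=
  le_add_of_nonneg_right (Int.emod_nonneg _ hn.ne')

theorem roundUp_lt (hn : 0 < n) (g : G) (Q : S) :
    roundUp n w p g Q < p (g • Q) - p Q + n :=
  add_lt_add_right (Int.emod_lt_of_pos _ hn) _

theorem roundUp_le (hn : 0 < n) {g : G} {Q : S} {a : ℤ} (ha : a ≡ w g Q [ZMOD n])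
    (hpa : p (g • Q) - p Q ≤ a) : roundUp n w p g Q ≤ a :=
  le_of_intModEq_of_lt_add ((roundUp_modEq g Q).trans ha.symm) (roundUp_lt hn g Q) hpa

theorem isOrderLevel_roundUp (hn : 0 < n) (hw : IsCocycleMod n w) :
    IsOrderLevel n w (roundUp n w p) where
  modEq := roundUp_modEq
  mul_le g h Q := by
    refine roundUp_le hn (((roundUp_modEq g _).add (roundUp_modEq h Q)).trans (hw g h Q).symm) ?_
    have hg := le_roundUp (w := w) (p := p) hn g (h • Q)
    have hh := le_roundUp (w := w) (p := p) hn h Q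
    rw [mul_smul]
    linarith
  one_le Q := roundUp_le hn (hw.one Q).symm (by rw [one_smul, sub_self])

theorem IsOrderLevel.exists_isPotentialPair_of_minimal [Finite G] (hn : 0 < n)
    (hw : IsCocycleMod n w) (hc : Minimal (IsOrderLevel n w) c) :
    ∃ p, IsPotentialPair n c p p := by
  obtain ⟨p, hpc, hpw⟩ := hc.prop.exists_potential hw
  obtain rfl : roundUp n w p = c := hc.eq_of_le (isOrderLevel_roundUp hn hw) fun g Q =>
    roundUp_le hn (hc.prop.modEq g Q) (hpc g Q)
  refine ⟨p, .of_modEq (le_roundUp hn) (roundUp_lt hn) fun h Q => ?_⟩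
  obtain ⟨g, hgQ, hg⟩ := hpw h Q
  exact ⟨g, hgQ, (roundUp_modEq g Q).trans hg⟩

theorem IsOrderLevel.minimal_of_isPotentialPair [Finite G] (hc : IsOrderLevel n w c)
    (hp : IsPotentialPair n c p p) : Minimal (IsOrderLevel n w) c := by
  refine ⟨hc, fun e he hec g Q => le_of_intModEq_of_lt_add
    ((hc.modEq g Q).trans (he.modEq g Q).symm) (hp.lt g Q) ?_⟩
  obtain ⟨b, hb, hcb⟩ := hp.exists_eq g⁻¹ (g • Q)
  rw [inv_smul_smul] at hb hcb
  have hloop := he.nonneg_of_smul_eq (s := b * g) (by rw [mul_smul, hb])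
  linarith [he.mul_le b g Q, hec b (g • Q)]

theorem IsOrderLevel.minimal_iff [Finite G] (hn : 0 < n) (hw : IsCocycleMod n w)
    (hc : IsOrderLevel n w c) :
    Minimal (IsOrderLevel n w) c ↔ ∃ p, IsPotentialPair n c p p :=
  ⟨exists_isPotentialPair_of_minimal hn hw, fun ⟨_, hp⟩ => hc.minimal_of_isPotentialPair hp⟩

/-- The largest excess of `m` under precomposition with an arrow. -/
noncomputable def leftResidual (m : G → S → ℤ) (g : G) (Q : S) : ℤ :=
  ⨆ k : G, m (g * k) (k⁻¹ • Q) - m k (k⁻¹ • Q)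

/-- The largest excess of `m` under postcomposition with an arrow. -/
noncomputable def rightResidual (m : G → S → ℤ) (b : G) (Q : S) : ℤ :=
  ⨆ k : G, m (k * b) Q - m k (b • Q)

section Finite

variable [Finite G]

theorem leftResidual_le_iff {g : G} {Q : S} {a : ℤ} :
    leftResidual m g Q ≤ a ↔ ∀ k, m (g * k) (k⁻¹ • Q) ≤ a + m k (k⁻¹ • Q) := by
  simp only [leftResidual, ciSup_le_iff (Set.finite_range _).bddAbove, sub_le_iff_le_add]

theorem rightResidual_le_iff {b : G} {Q : S} {a : ℤ} :
    rightResidual m b Q ≤ a ↔ ∀ k, m (k * b) Q ≤ m k (b • Q) + a := by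
  simp only [rightResidual, ciSup_le_iff (Set.finite_range _).bddAbove, sub_le_iff_le_add']

theorem mul_le_leftResidual_add (g k : G) (Q : S) :
    m (g * k) Q ≤ leftResidual m g (k • Q) + m k Q := by
  simpa using leftResidual_le_iff.1 (le_refl (leftResidual m g (k • Q))) k

theorem mul_le_add_rightResidual (k b : G) (Q : S) :
    m (k * b) Q ≤ m k (b • Q) + rightResidual m b Q :=
  rightResidual_le_iff.1 le_rfl k

theorem exists_leftResidual_eq (g : G) (Q : S) :
    ∃ k, leftResidual m g Q = m (g * k) (k⁻¹ • Q) - m k (k⁻¹ • Q) := by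
  obtain ⟨k, hk⟩ := exists_eq_ciSup_of_finite
    (f := fun k : G => m (g * k) (k⁻¹ • Q) - m k (k⁻¹ • Q))
  exact ⟨k, hk.symm⟩

theorem exists_rightResidual_eq (b : G) (Q : S) :
    ∃ k, rightResidual m b Q = m (k * b) Q - m k (b • Q) := by
  obtain ⟨k, hk⟩ := exists_eq_ciSup_of_finite (f := fun k : G => m (k * b) Q - m k (b • Q))
  exact ⟨k, hk.symm⟩

theorem isOrderLevel_leftResidual (hw : IsCocycleMod n w)
    (hm : ∀ g Q, m g Q ≡ w g Q [ZMOD n]) : IsOrderLevel n w (leftResidual m) where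
  modEq g Q := by
    obtain ⟨k, hk⟩ := exists_leftResidual_eq (m := m) g Q
    rw [hk]
    simpa using ((hm _ _).sub (hm _ _)).trans ((hw g k (k⁻¹ • Q)).sub_right (w k (k⁻¹ • Q)))
  mul_le g h Q := leftResidual_le_iff.2 fun k => by
    have hg := mul_le_leftResidual_add (m := m) g (h * k) (k⁻¹ • Q)
    have hh := mul_le_leftResidual_add (m := m) h k (k⁻¹ • Q)
    rw [mul_smul, smul_inv_smul, ← mul_assoc] at hg
    rw [smul_inv_smul] at hh
    linarith
  one_le Q := leftResidual_le_iff.2 fun k => by simp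

theorem isOrderLevel_rightResidual (hw : IsCocycleMod n w)
    (hm : ∀ g Q, m g Q ≡ w g Q [ZMOD n]) : IsOrderLevel n w (rightResidual m) where
  modEq b Q := by
    obtain ⟨k, hk⟩ := exists_rightResidual_eq (m := m) b Q
    rw [hk]
    simpa using ((hm _ _).sub (hm _ _)).trans ((hw k b Q).sub_right (w k (b • Q)))
  mul_le g h Q := rightResidual_le_iff.2 fun k => by
    have hh := mul_le_add_rightResidual (m := m) (k * g) h Q
    have hg := mul_le_add_rightResidual (m := m) k g (h • Q)
    rw [← mul_assoc, mul_smul]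
    linarith
  one_le Q := rightResidual_le_iff.2 fun k => by simp

theorem leftResidual_le_self_iff :
    leftResidual m ≤ m ↔ ∀ (g h : G) Q, m (g * h) Q ≤ m g (h • Q) + m h Q := by
  refine forall_congr' fun g => ?_
  simp only [Pi.le_def, leftResidual_le_iff]
  rw [forall_comm]
  refine forall_congr' fun h => ?_
  rw [(MulAction.surjective h).forall]
  simp only [inv_smul_smul]

theorem hasFiniteSupport_leftResidual (hm : ∀ g, (m g).HasFiniteSupport) (g : G) :
    (leftResidual m g).HasFiniteSupport :=
  Function.HasFiniteSupport.iSup fun k =>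
    hasFiniteSupport_comp_smul ((hm (g * k)).sub (hm k)) k⁻¹

theorem hasFiniteSupport_rightResidual (hm : ∀ g, (m g).HasFiniteSupport) (b : G) :
    (rightResidual m b).HasFiniteSupport :=
  Function.HasFiniteSupport.iSup fun k =>
    (hm (k * b)).sub (hasFiniteSupport_comp_smul (hm k) b)

theorem IsPotentialPair.of_leftResidual
    (hp : IsPotentialPair n (leftResidual m) p p) : ∃ q, IsPotentialPair n m p q := by
  have exists_max (Q : S) : ∃ k : G, ∀ g : G, p (g • Q) - m g Q ≤ p (k • Q) - m k Q :=
    Finite.exists_max fun g : G => p (g • Q) - m g Q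
  choose k hk using exists_max
  refine ⟨fun Q => p (k Q • Q) - m (k Q) Q, fun g Q => ?_, fun g Q => ?_, fun h Q => ?_⟩
  · linarith [hk Q g]
  · have hlt := hp.lt (g * (k Q)⁻¹) (k Q • Q)
    have hle := mul_le_leftResidual_add (m := m) (g * (k Q)⁻¹) (k Q) Q
    rw [inv_mul_cancel_right] at hle
    rw [← mul_smul, inv_mul_cancel_right] at hlt
    linarith
  · obtain ⟨g, hgQ, hg⟩ := hp.exists_eq (h * (k Q)⁻¹) (k Q • Q)
    rw [← mul_smul, ← mul_smul, inv_mul_cancel_right, mul_smul] at hgQ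
    have hle := mul_le_leftResidual_add (m := m) g (k Q) Q
    rw [← mul_smul, inv_mul_cancel_right] at hg
    refine ⟨g * k Q, by rw [mul_smul, hgQ], le_antisymm (by linarith) ?_⟩
    have := hk Q (g * k Q)
    rw [mul_smul, hgQ] at this
    linarith

theorem IsPotentialPair.right_right (hm : IsCocycleMod n m) (hpq : IsPotentialPair n m p q) :
    IsPotentialPair n (rightResidual m) q q := by
  refine .of_modEq (fun b Q => ?_) (fun b Q => ?_) (fun h Q => ?_)
  · obtain ⟨k, hkQ, hk⟩ := hpq.exists_eq 1 (b • Q)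
    have hle := hpq.le (k * b) Q
    have := mul_le_add_rightResidual (m := m) k b Q
    rw [mul_smul, hkQ] at hle
    linarith
  · obtain ⟨k, hk⟩ := exists_rightResidual_eq (m := m) b Q
    have hlt := hpq.lt (k * b) Q
    have hle := hpq.le k (b • Q)
    rw [mul_smul] at hlt
    linarith
  · obtain ⟨a, haQ, ha⟩ := hpq.exists_eq h Q
    obtain ⟨k, hkQ, hk⟩ := hpq.exists_eq 1 (h • Q)
    rw [one_smul] at hkQ hk
    have hbQ : (k⁻¹ * a) • Q = h • Q := by rw [mul_smul, haQ, inv_smul_eq_iff, hkQ]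
    have hmod := (isOrderLevel_rightResidual hm fun _ _ => .rfl).modEq (k⁻¹ * a) Q
    have hcocycle := (hm k (k⁻¹ * a) Q).symm.sub_right (p (h • Q) - q (h • Q))
    rw [mul_inv_cancel_left, ha, hbQ, hk, add_sub_cancel_left, sub_sub_sub_cancel_left]
      at hcocycle
    exact ⟨k⁻¹ * a, hbQ, hmod.trans hcocycle⟩

end Finite

/-- The function on arrows obtained by inverting the arrows; it exchanges the two residuals. -/
def reverseArrows (m : G → S → ℤ) (g : G) (Q : S) : ℤ := m g⁻¹ (g • Q)

theorem reverseArrows_reverseArrows (m : G → S → ℤ) : reverseArrows (reverseArrows m) = m := by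
  ext g Q
  simp [reverseArrows]

theorem reverseArrows_leftResidual (m : G → S → ℤ) :
    reverseArrows (leftResidual m) = rightResidual (reverseArrows m) := by
  ext g Q
  refine (Equiv.inv G).iSup_congr fun k => ?_
  simp [reverseArrows, mul_smul]

theorem reverseArrows_rightResidual (m : G → S → ℤ) :
    reverseArrows (rightResidual m) = leftResidual (reverseArrows m) := by
  rw [← reverseArrows_reverseArrows (leftResidual _), reverseArrows_leftResidual,
    reverseArrows_reverseArrows]

theorem IsCocycleMod.reverseArrows (hw : IsCocycleMod n w) :
    IsCocycleMod n (reverseArrows w) := fun g h Q => by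
  have := hw h⁻¹ g⁻¹ (g • h • Q)
  rw [inv_smul_smul, ← mul_inv_rev, ← mul_smul, add_comm] at this
  simpa only [_root_.reverseArrows, mul_smul] using this

theorem IsPotentialPair.reverseArrows (hpq : IsPotentialPair n m p q) :
    IsPotentialPair n (reverseArrows m) (-q) (-p) where
  le g Q := by simpa [_root_.reverseArrows, neg_add_eq_sub] using hpq.le g⁻¹ (g • Q)
  lt g Q := by simpa [_root_.reverseArrows, neg_add_eq_sub] using hpq.lt g⁻¹ (g • Q)
  exists_eq h Q := by
    obtain ⟨g, hgQ, hg⟩ := hpq.exists_eq h⁻¹ (h • Q)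
    rw [inv_smul_smul] at hgQ hg
    have hgQ' : g⁻¹ • Q = h • Q := inv_smul_eq_iff.2 hgQ.symm
    refine ⟨g⁻¹, hgQ', ?_⟩
    simp only [_root_.reverseArrows, inv_inv, hgQ', hg, Pi.neg_apply]
    ring

theorem exists_isPotentialPair_rightResidual [Finite G] (hm : IsCocycleMod n m)
    (h : ∃ p, IsPotentialPair n (leftResidual m) p p) :
    ∃ q, IsPotentialPair n (rightResidual m) q q := by
  obtain ⟨p, hp⟩ := h
  obtain ⟨q, hpq⟩ := hp.of_leftResidual
  exact ⟨q, hpq.right_right hm⟩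

theorem exists_isPotentialPair_leftResidual [Finite G] (hm : IsCocycleMod n m)
    (h : ∃ p, IsPotentialPair n (rightResidual m) p p) :
    ∃ q, IsPotentialPair n (leftResidual m) q q := by
  obtain ⟨p, hp⟩ := h
  have hrev := hp.reverseArrows
  rw [reverseArrows_rightResidual] at hrev
  obtain ⟨q, hq⟩ := exists_isPotentialPair_rightResidual hm.reverseArrows ⟨_, hrev⟩
  rw [← reverseArrows_leftResidual] at hq
  exact ⟨-q, by simpa only [reverseArrows_reverseArrows] using hq.reverseArrows⟩

theorem minimal_leftResidual_iff_minimal_rightResidual [Finite G] (hn : 0 < n)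
    (hw : IsCocycleMod n w) (hm : ∀ g Q, m g Q ≡ w g Q [ZMOD n]) :
    Minimal (IsOrderLevel n w) (leftResidual m) ↔
      Minimal (IsOrderLevel n w) (rightResidual m) := by
  rw [(isOrderLevel_leftResidual hw hm).minimal_iff hn hw,
    (isOrderLevel_rightResidual hw hm).minimal_iff hn hw]
  exact ⟨exists_isPotentialPair_rightResidual (hw.congr hm),
    exists_isPotentialPair_leftResidual (hw.congr hm)⟩

end ActionGroupoid

open scoped nonZeroDivisors Pointwise
open IsDedekindDomain

section FractionalIdeals

variable {R K : Type*} [CommRing R] [IsDedekindDomain R] [Field K] [Algebra R K]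
  [IsFractionRing R K]

open FractionalIdeal in
theorem fractionalIdeal_le_iff_count_le {I J : FractionalIdeal R⁰ K} (hI : I ≠ 0) (hJ : J ≠ 0) :
    I ≤ J ↔ ∀ P : HeightOneSpectrum R, count K P J ≤ count K P I := by
  refine ⟨fun h P => count_mono K P hI h, fun h => ?_⟩
  have hne : J⁻¹ * I ≠ 0 := mul_ne_zero (inv_ne_zero hJ) hI
  have hle : J⁻¹ * I ≤ 1 := by
    rw [← finprod_heightOneSpectrum_factorization' K hne]
    refine finprod_induction (fun L : FractionalIdeal R⁰ K => L ≤ 1) le_rfl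
      (fun L L' hL hL' => mul_le_one' hL hL') fun P => ?_
    have h0 : 0 ≤ count K P (J⁻¹ * I) := by
      rw [count_mul K P (inv_ne_zero hJ) hI, count_inv]
      linarith [h P]
    obtain ⟨k, hk⟩ := Int.eq_ofNat_of_zero_le h0
    rw [hk, zpow_natCast]
    exact pow_le_one' coeIdeal_le_one k
  calc I = J * (J⁻¹ * I) := by rw [← mul_assoc, mul_inv_cancel₀ hJ, one_mul]
    _ ≤ J * 1 := by gcongr
    _ = J := mul_one J

end FractionalIdeals

section Action

variable {R G : Type*} [CommRing R] [Group G] [MulSemiringAction G R]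

instance heightOneSpectrumMulAction : MulAction G (HeightOneSpectrum R) where
  smul g P := ⟨g • P.asIdeal, P.isPrime.smul g, fun h => P.ne_bot <| by
    rw [← inv_smul_smul g P.asIdeal, h, Ideal.smul_bot]⟩
  one_smul P := HeightOneSpectrum.ext (one_smul G P.asIdeal)
  mul_smul g h P := HeightOneSpectrum.ext (mul_smul g h P.asIdeal)

theorem asIdeal_smul (g : G) (P : HeightOneSpectrum R) : (g • P).asIdeal = g • P.asIdeal := rfl

variable {K : Type*} [Field K] [Algebra R K] [IsFractionRing R K]

theorem fracAut_algebraMap (g : G) (r : R) :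
    fracAut R K g (algebraMap R K r) = algebraMap R K (g • r) := by
  simp [fracAut]

variable [IsDedekindDomain R]

variable (K) in
/-- The automorphism `I ↦ σ_g(I)` of the semiring of fractional ideals. -/
noncomputable def fracIdealAut (g : G) : FractionalIdeal R⁰ K ≃+* FractionalIdeal R⁰ K :=
  FractionalIdeal.ringEquivOfRingEquiv K K (MulSemiringAction.toRingEquiv G R g)

theorem mem_fracIdealAut {g : G} {I : FractionalIdeal R⁰ K} {x : K} :
    x ∈ fracIdealAut K g I ↔ ∃ y ∈ I, fracAut R K g y = x := Iff.rfl

theorem fracIdealAut_coeIdeal (g : G) (I : Ideal R) :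
    fracIdealAut K g (I : FractionalIdeal R⁰ K) = ((g • I : Ideal R) : FractionalIdeal R⁰ K) := by
  ext x
  simp only [mem_fracIdealAut, FractionalIdeal.mem_coeIdeal]
  constructor
  · rintro ⟨_, ⟨r, hr, rfl⟩, rfl⟩
    exact ⟨g • r, Ideal.smul_mem_pointwise_smul _ _ _ hr, (fracAut_algebraMap g r).symm⟩
  · rintro ⟨r, hr, rfl⟩
    refine ⟨_, ⟨g⁻¹ • r, Ideal.mem_pointwise_smul_iff_inv_smul_mem.1 hr, rfl⟩, ?_⟩
    rw [fracAut_algebraMap, smul_inv_smul]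

theorem fracIdealAut_spanSingleton (g : G) (x : K) :
    fracIdealAut K g (FractionalIdeal.spanSingleton R⁰ x) =
      FractionalIdeal.spanSingleton R⁰ (fracAut R K g x) := by
  have map_smul (r : R) : fracAut R K g (r • x) = (g • r) • fracAut R K g x := by
    simp only [Algebra.smul_def, map_mul, fracAut_algebraMap]
  ext y
  simp only [mem_fracIdealAut, FractionalIdeal.mem_spanSingleton, exists_exists_eq_and, map_smul]
  exact ((MulAction.surjective g).exists (p := fun r : R => r • fracAut R K g x = y)).symm

open FractionalIdeal in
theorem count_smul_fracIdealAut (g : G) (P : HeightOneSpectrum R) {I : FractionalIdeal R⁰ K}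
    (hI : I ≠ 0) : count K (g • P) (fracIdealAut K g I) = count K P I := by
  have hfactor : fracIdealAut K g I =
      ∏ᶠ Q : HeightOneSpectrum R, (Q.asIdeal : FractionalIdeal R⁰ K) ^ count K (g⁻¹ • Q) I := by
    calc fracIdealAut K g I
        = fracIdealAut K g (∏ᶠ Q : HeightOneSpectrum R,
            (Q.asIdeal : FractionalIdeal R⁰ K) ^ count K Q I) := by
          rw [finprod_heightOneSpectrum_factorization' K hI]
      _ = ∏ᶠ Q : HeightOneSpectrum R,
            ((g • Q).asIdeal : FractionalIdeal R⁰ K) ^ count K (g⁻¹ • g • Q) I := by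
          rw [MulEquivClass.map_finprod]
          simp only [map_zpow₀, fracIdealAut_coeIdeal, asIdeal_smul, inv_smul_smul]
      _ = _ := finprod_comp_equiv (MulAction.toPerm g)
          (f := fun Q => (Q.asIdeal : FractionalIdeal R⁰ K) ^ count K (g⁻¹ • Q) I)
  have hfin : ∀ᶠ Q : HeightOneSpectrum R in Filter.cofinite, count K (g⁻¹ • Q) I = 0 :=
    hasFiniteSupport_comp_smul (finite_factors I) g⁻¹
  rw [hfactor, count_finprod K _ _ hfin, inv_smul_smul]

theorem hasFiniteSupport_count_smul (g : G) (I : FractionalIdeal R⁰ K) :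
    (fun Q : HeightOneSpectrum R => FractionalIdeal.count K (g • Q) I).HasFiniteSupport :=
  hasFiniteSupport_comp_smul (FractionalIdeal.finite_factors I) g

end Action

namespace CrystallineGraded

section Coefficients

variable {R K G A : Type*} [CommRing R] [Field K] [Algebra R K] [IsFractionRing R K]
  [Group G] [Fintype G] [MulSemiringAction G R] [Ring A] (C : CrystallineGraded R K G A)

/-- The homogeneous element `x u_g`. -/
def hom (g : G) (x : K) : A := C.incl x * C.u g

/-- The coefficients of an element of `A` with respect to the basis `u_g`. -/
noncomputable def coeff (a : A) : G → K := (C.existsUnique_coeff a).choose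

theorem sum_coeff (a : A) : ∑ g, C.hom g (C.coeff a g) = a :=
  (C.existsUnique_coeff a).choose_spec.1.symm

theorem coeff_eq {a : A} {c : G → K} (h : a = ∑ g, C.hom g (c g)) : C.coeff a = c :=
  ((C.existsUnique_coeff a).choose_spec.2 c h).symm

theorem hom_add (g : G) (x y : K) : C.hom g (x + y) = C.hom g x + C.hom g y := by
  simp [hom, add_mul]

theorem hom_zero (g : G) : C.hom g 0 = 0 := by simp [hom]

theorem incl_mul_hom (k : K) (g : G) (x : K) : C.incl k * C.hom g x = C.hom g (k * x) := by
  simp [hom, mul_assoc]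

theorem inclR_mul_hom (r : R) (g : G) (x : K) : C.inclR r * C.hom g x = C.hom g (r • x) := by
  rw [inclR, RingHom.comp_apply, incl_mul_hom, Algebra.smul_def]

theorem hom_mul_incl (g : G) (x k : K) :
    C.hom g x * C.incl k = C.hom g (x * fracAut R K g k) := by
  rw [hom, mul_assoc, C.u_mul_incl, ← mul_assoc, ← map_mul, hom]

theorem hom_mul_inclR (g : G) (x : K) (r : R) :
    C.hom g x * C.inclR r = C.hom g ((g • r) • x) := by
  rw [inclR, RingHom.comp_apply, hom_mul_incl, fracAut_algebraMap, Algebra.smul_def, mul_comm]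

theorem hom_mul_hom (g h : G) (x y : K) :
    C.hom g x * C.hom h y = C.hom (g * h) (x * fracAut R K g y * C.α g h) := by
  rw [hom, hom, mul_assoc, ← mul_assoc (C.u g), C.u_mul_incl, mul_assoc, C.u_mul_u]
  simp only [hom, map_mul, mul_assoc]

theorem hom_one_one : C.hom 1 1 = 1 := by simp [hom, C.u_one]

theorem coeff_hom [DecidableEq G] (g : G) (x : K) : C.coeff (C.hom g x) = Pi.single g x := by
  apply C.coeff_eq
  rw [Finset.sum_eq_single g]
  · simp
  · intro h _ hne
    simp [Pi.single_eq_of_ne hne, hom_zero]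
  · simp

theorem hom_injective (g : G) : Function.Injective (C.hom g) := by
  classical
  intro x y h
  simpa [coeff_hom] using congrFun (congrArg C.coeff h) g

theorem coeff_add (a b : A) : C.coeff (a + b) = C.coeff a + C.coeff b := by
  apply C.coeff_eq
  simp only [Pi.add_apply, hom_add, Finset.sum_add_distrib, sum_coeff]

theorem coeff_zero : C.coeff 0 = 0 := C.coeff_eq (by simp [hom_zero])

theorem coeff_neg (a : A) : C.coeff (-a) = -C.coeff a := by
  rw [eq_neg_iff_add_eq_zero, ← coeff_add, neg_add_cancel, coeff_zero]

theorem coeff_mul_hom (a : A) (g h : G) (y : K) :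
    C.coeff (a * C.hom h y) (g * h) = C.coeff a g * fracAut R K g y * C.α g h := by
  have hcoeff : C.coeff (a * C.hom h y) =
      fun j => C.coeff a (j * h⁻¹) * fracAut R K (j * h⁻¹) y * C.α (j * h⁻¹) h := by
    apply C.coeff_eq
    conv_lhs => rw [← C.sum_coeff a, Finset.sum_mul]
    rw [← Equiv.sum_comp (Equiv.mulRight h) fun j =>
      C.hom j (C.coeff a (j * h⁻¹) * fracAut R K (j * h⁻¹) y * C.α (j * h⁻¹) h)]
    simp only [hom_mul_hom, Equiv.coe_mulRight, mul_inv_cancel_right]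
  simp only [hcoeff, mul_inv_cancel_right]

theorem coeff_hom_mul (a : A) (g h : G) (x : K) :
    C.coeff (C.hom g x * a) (g * h) = x * fracAut R K g (C.coeff a h) * C.α g h := by
  have hcoeff : C.coeff (C.hom g x * a) =
      fun j => x * fracAut R K g (C.coeff a (g⁻¹ * j)) * C.α g (g⁻¹ * j) := by
    apply C.coeff_eq
    conv_lhs => rw [← C.sum_coeff a, Finset.mul_sum]
    rw [← Equiv.sum_comp (Equiv.mulLeft g) fun j =>
      C.hom j (x * fracAut R K g (C.coeff a (g⁻¹ * j)) * C.α g (g⁻¹ * j))]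
    simp only [hom_mul_hom, Equiv.coe_mulLeft, inv_mul_cancel_left]
  simp only [hcoeff, inv_mul_cancel_left]

theorem coeff_incl_mul (k : K) (a : A) (g : G) : C.coeff (C.incl k * a) g = k * C.coeff a g := by
  refine congrFun (C.coeff_eq (c := fun g => k * C.coeff a g) ?_) g
  simp only [← incl_mul_hom, ← Finset.mul_sum, sum_coeff]

theorem coeff_mul_incl (k : K) (a : A) (g : G) :
    C.coeff (a * C.incl k) g = C.coeff a g * fracAut R K g k := by
  refine congrFun (C.coeff_eq (c := fun g => C.coeff a g * fracAut R K g k) ?_) g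
  simp only [← hom_mul_incl, ← Finset.sum_mul, sum_coeff]

theorem coeff_inclR_mul (r : R) (a : A) (g : G) :
    C.coeff (C.inclR r * a) g = r • C.coeff a g := by
  rw [inclR, RingHom.comp_apply, coeff_incl_mul, Algebra.smul_def]

theorem coeff_mul_inclR (r : R) (a : A) (g : G) :
    C.coeff (a * C.inclR r) g = (g • r) • C.coeff a g := by
  rw [inclR, RingHom.comp_apply, coeff_mul_incl, fracAut_algebraMap, Algebra.smul_def, mul_comm]

theorem coeff_injective : Function.Injective C.coeff := fun a b h => by
  rw [← C.sum_coeff a, ← C.sum_coeff b, h]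

theorem α_cocycle (g h k : G) :
    C.α g h * C.α (g * h) k = fracAut R K g (C.α h k) * C.α g (h * k) := by
  have hassoc := mul_assoc (C.hom g 1) (C.hom h 1) (C.hom k 1)
  simp only [hom_mul_hom, map_one, one_mul, mul_one, mul_assoc g h k] at hassoc
  exact C.hom_injective _ hassoc

theorem α_one_left (g : G) : C.α 1 g = 1 := C.hom_injective g <| by
  have h := C.hom_mul_hom 1 g 1 1
  rw [hom_one_one, one_mul, map_one, one_mul, one_mul, one_mul] at h
  exact h.symm

theorem mem_of_hom_coeff_mem {D : AddSubgroup A} {a : A} (h : ∀ g, C.hom g (C.coeff a g) ∈ D) :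
    a ∈ D := by
  rw [← C.sum_coeff a]
  exact D.sum_mem fun g _ => h g

theorem IsGraded.hom_coeff_mem {C : CrystallineGraded R K G A} {T : Set A} (hT : C.IsGraded T)
    {a : A} (ha : a ∈ T) (g : G) : C.hom g (C.coeff a g) ∈ T :=
  hT (C.coeff a) (by rw [← C.sum_coeff a] at ha; exact ha) g

theorem hom_mem_of_mem_span {D : AddSubgroup A} {g : G} {T : Set K} {x : K}
    (hT : ∀ r : R, ∀ t ∈ T, C.hom g (r • t) ∈ D) (hx : x ∈ Submodule.span R T) :
    C.hom g x ∈ D := by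
  induction hx using Submodule.closure_induction with
  | zero => simp only [hom_zero, D.zero_mem]
  | add x y _ _ hx hy =>
    rw [hom_add]
    exact D.add_mem hx hy
  | smul_mem r t ht => exact hT r t ht

end Coefficients

section GradedLattice

variable {R K G A : Type*} [CommRing R] [Field K] [Algebra R K] [IsFractionRing R K]
  [Group G] [Fintype G] [MulSemiringAction G R] [Ring A] (C : CrystallineGraded R K G A)

theorem leftSpan_le {B : Type*} [Semiring B] {f : B →+* A} {S : Set A} {D : AddSubgroup A}
    (h : ∀ b, ∀ s ∈ S, f b * s ∈ D) : leftSpan f S ≤ D := by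
  refine (AddSubgroup.closure_le D).2 ?_
  rintro _ ⟨b, s, hs, rfl⟩
  exact h b s hs

theorem rightSpan_le {B : Type*} [Semiring B] {f : B →+* A} {S : Set A} {D : AddSubgroup A}
    (h : ∀ b, ∀ s ∈ S, s * f b ∈ D) : rightSpan f S ≤ D := by
  refine (AddSubgroup.closure_le D).2 ?_
  rintro _ ⟨b, s, hs, rfl⟩
  exact h b s hs

/-- The graded subgroup `⊕_g J_g u_g` of `A` with prescribed fractional ideals `J_g` as
components. -/
def gradedLattice (J : G → FractionalIdeal R⁰ K) : AddSubgroup A where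
  carrier := {a | ∀ g, C.coeff a g ∈ J g}
  add_mem' ha hb g := by
    rw [coeff_add]
    exact (J g : Submodule R K).add_mem (ha g) (hb g)
  zero_mem' g := by
    rw [coeff_zero]
    exact (J g : Submodule R K).zero_mem
  neg_mem' ha g := by
    rw [coeff_neg]
    exact (J g : Submodule R K).neg_mem (ha g)

variable {C} {J J' : G → FractionalIdeal R⁰ K}

theorem mem_gradedLattice {a : A} : a ∈ C.gradedLattice J ↔ ∀ g, C.coeff a g ∈ J g := Iff.rfl

theorem hom_mem_gradedLattice {g : G} {x : K} : C.hom g x ∈ C.gradedLattice J ↔ x ∈ J g := by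
  classical
  simp only [mem_gradedLattice, coeff_hom]
  refine ⟨fun h => by simpa using h g, fun hx k => ?_⟩
  rcases eq_or_ne k g with rfl | hk
  · simpa using hx
  · rw [Pi.single_eq_of_ne hk]
    exact (J k : Submodule R K).zero_mem

theorem gradedLattice_le_iff {D : AddSubgroup A} :
    C.gradedLattice J ≤ D ↔ ∀ g, ∀ x ∈ J g, C.hom g x ∈ D :=
  ⟨fun h _ _ hx => h (hom_mem_gradedLattice.2 hx), fun h _ ha =>
    C.mem_of_hom_coeff_mem fun g => h g _ (ha g)⟩

theorem gradedLattice_le_gradedLattice_iff :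
    C.gradedLattice J ≤ C.gradedLattice J' ↔ ∀ g, J g ≤ J' g := by
  simp only [gradedLattice_le_iff, hom_mem_gradedLattice]
  rfl

theorem isGraded_gradedLattice : C.IsGraded (C.gradedLattice J : Set A) := by
  intro c hc g
  have hcoeff : C.coeff (∑ g, C.incl (c g) * C.u g) = c := C.coeff_eq rfl
  have hcg := hc g
  rw [hcoeff] at hcg
  exact hom_mem_gradedLattice.2 hcg

theorem inclR_mul_mem_gradedLattice (r : R) {a : A} (ha : a ∈ C.gradedLattice J) :
    C.inclR r * a ∈ C.gradedLattice J := fun g => by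
  rw [coeff_inclR_mul]
  exact (J g : Submodule R K).smul_mem r (ha g)

theorem mul_inclR_mem_gradedLattice (r : R) {a : A} (ha : a ∈ C.gradedLattice J) :
    a * C.inclR r ∈ C.gradedLattice J := fun g => by
  rw [coeff_mul_inclR]
  exact (J g : Submodule R K).smul_mem _ (ha g)

theorem exists_finset_span_gradedLattice [IsDomain R] [IsNoetherianRing R] :
    ∃ S : Finset A, leftSpan C.inclR (S : Set A) = C.gradedLattice J ∧
      rightSpan C.inclR (S : Set A) = C.gradedLattice J := by
  classical
  have hfg (g : G) : (J g : Submodule R K).FG :=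
    FractionalIdeal.fg_of_isNoetherianRing (le_refl R⁰) (J g)
  choose T hT using hfg
  let S : Finset A := Finset.univ.biUnion fun g => (T g).image (C.hom g)
  have hom_mem_S {g : G} {t : K} (ht : t ∈ T g) : C.hom g t ∈ (S : Set A) :=
    Finset.mem_biUnion.2 ⟨g, Finset.mem_univ g, Finset.mem_image_of_mem _ ht⟩
  have hS {s : A} (hs : s ∈ (S : Set A)) : s ∈ C.gradedLattice J := by
    obtain ⟨g, -, hs⟩ := Finset.mem_biUnion.1 hs
    obtain ⟨t, ht, rfl⟩ := Finset.mem_image.1 hs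
    rw [hom_mem_gradedLattice, ← FractionalIdeal.mem_coe, ← hT g]
    exact Submodule.subset_span ht
  refine ⟨S, (leftSpan_le fun r s hs => inclR_mul_mem_gradedLattice r (hS hs)).antisymm ?_,
    (rightSpan_le fun r s hs => mul_inclR_mem_gradedLattice r (hS hs)).antisymm ?_⟩ <;>
  refine gradedLattice_le_iff.2 fun g x hx => ?_ <;>
  rw [← FractionalIdeal.mem_coe, ← hT g] at hx <;>
  refine C.hom_mem_of_mem_span (fun r t ht => AddSubgroup.subset_closure ?_) hx
  · exact ⟨r, _, hom_mem_S ht, (C.inclR_mul_hom r g t).symm⟩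
  · exact ⟨g⁻¹ • r, _, hom_mem_S ht, by rw [hom_mul_inclR, smul_inv_smul]⟩

theorem isLattice_gradedLattice [IsDomain R] [IsNoetherianRing R] :
    C.IsLattice (C.gradedLattice J) := by
  obtain ⟨S, hleft, hright⟩ := exists_finset_span_gradedLattice (C := C) (J := J)
  have isUnit_inclR {r : R} (hr : r ≠ 0) : IsUnit (C.inclR r) :=
    (IsUnit.mk0 (algebraMap R K r) (by simpa using hr)).map C.incl
  exact
    { mul_left_mem := fun r _ hm => inclR_mul_mem_gradedLattice r hm
      mul_right_mem := fun r _ hm => mul_inclR_mem_gradedLattice r hm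
      invariant_comm := fun r hr m _ => C.coeff_injective <| funext fun g => by
        rw [coeff_inclR_mul, coeff_mul_inclR, hr]
      torsionfree_left := fun r m _ h =>
        or_iff_not_imp_left.2 fun hr => (isUnit_inclR hr).mul_right_eq_zero.1 h
      torsionfree_right := fun r m _ h =>
        or_iff_not_imp_left.2 fun hr => (isUnit_inclR hr).mul_left_eq_zero.1 h
      fg_left := ⟨S, hleft⟩
      fg_right := ⟨S, hright⟩ }

theorem isFullLattice_gradedLattice [IsDomain R] [IsNoetherianRing R] (hJ : ∀ g, J g ≠ 0) :
    C.IsFullLattice (C.gradedLattice J) := by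
  have exists_ne_zero (g : G) : ∃ y ≠ 0, C.hom g y ∈ (C.gradedLattice J : Set A) := by
    obtain ⟨y, hy, hy0⟩ := Submodule.exists_mem_ne_zero_of_ne_bot
      (FractionalIdeal.coeToSubmodule_ne_bot.2 (hJ g))
    exact ⟨y, hy0, hom_mem_gradedLattice.2 hy⟩
  refine ⟨isLattice_gradedLattice, ?_, ?_⟩ <;>
  refine eq_top_iff.2 fun a _ => C.mem_of_hom_coeff_mem fun g => ?_ <;>
  obtain ⟨y, hy0, hy⟩ := exists_ne_zero g
  · refine AddSubgroup.subset_closure ⟨C.coeff a g / y, _, hy, ?_⟩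
    rw [incl_mul_hom, div_mul_cancel₀ _ hy0]
  · refine AddSubgroup.subset_closure ⟨(fracAut R K g).symm (C.coeff a g / y), _, hy, ?_⟩
    rw [hom_mul_incl, RingEquiv.apply_symm_apply, mul_div_cancel₀ _ hy0]

theorem ne_zero_of_leftSpan_gradedLattice_eq_top
    (h : leftSpan C.incl (C.gradedLattice J : Set A) = ⊤) (g : G) : J g ≠ 0 := by
  classical
  intro hJ
  let D : AddSubgroup A := ((Pi.evalAddMonoidHom (fun _ : G => K) g).comp
    (AddMonoidHom.mk' C.coeff C.coeff_add)).ker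
  have hD : leftSpan C.incl (C.gradedLattice J : Set A) ≤ D := leftSpan_le fun k a ha => by
    have hag : C.coeff a g = 0 := by simpa [hJ] using ha g
    simp [D, coeff_incl_mul, hag]
  have hhom : C.hom g 1 ∈ D := hD (h ▸ AddSubgroup.mem_top _)
  simp [D, coeff_hom] at hhom

theorem IsFullLattice.exists_eq_gradedLattice {M : AddSubgroup A}
    (hM : C.IsFullLattice M) (hgr : C.IsGraded (M : Set A)) :
    ∃ J : G → FractionalIdeal R⁰ K, (∀ g, J g ≠ 0) ∧ M = C.gradedLattice J := by
  obtain ⟨S, hS⟩ := hM.fg_left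
  let J (g : G) : FractionalIdeal R⁰ K := FractionalIdeal.spanFinset R S (C.coeff · g)
  have hSJ {s : A} (hs : s ∈ (S : Set A)) : s ∈ C.gradedLattice J := fun g =>
    Submodule.subset_span ⟨s, hs, rfl⟩
  have hSM {s : A} (hs : s ∈ (S : Set A)) : s ∈ M := by
    rw [← hS]
    exact AddSubgroup.subset_closure ⟨1, s, hs, by simp⟩
  obtain rfl : M = C.gradedLattice J := by
    refine le_antisymm ?_ (gradedLattice_le_iff.2 fun g x hx => C.hom_mem_of_mem_span ?_ hx)
    · rw [← hS]
      exact leftSpan_le fun r s hs => inclR_mul_mem_gradedLattice r (hSJ hs)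
    · rintro r _ ⟨s, hs, rfl⟩
      rw [← inclR_mul_hom]
      exact hM.mul_left_mem r _ (hgr.hom_coeff_mem (hSM hs) g)
  exact ⟨J, ne_zero_of_leftSpan_gradedLattice_eq_top hM.left_full, rfl⟩

theorem IsGrOrder.exists_eq_gradedLattice {Λ : Subring A} (hΛ : C.IsGrOrder Λ) :
    ∃ J : G → FractionalIdeal R⁰ K, (∀ g, J g ≠ 0) ∧ Λ.toAddSubgroup = C.gradedLattice J :=
  hΛ.isFullLattice.exists_eq_gradedLattice hΛ.isGraded

end GradedLattice

section Level

open FractionalIdeal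

variable {R K G A : Type*} [CommRing R] [IsDedekindDomain R] [Field K] [Algebra R K]
  [IsFractionRing R K] [Group G] [Fintype G] [MulSemiringAction G R] [Ring A]
  (C : CrystallineGraded R K G A)

/-- The fractional ideal `L` with `(I u_g)(J u_h) = L u_{gh}`. -/
noncomputable def componentMul (g h : G) (I J : FractionalIdeal R⁰ K) : FractionalIdeal R⁰ K :=
  spanSingleton R⁰ (C.α g h) * I * fracIdealAut K g J

theorem componentMul_spanSingleton_left_le_iff {g h : G} {x : K} {J L : FractionalIdeal R⁰ K} :
    C.componentMul g h (spanSingleton R⁰ x) J ≤ L ↔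
      ∀ y ∈ J, x * fracAut R K g y * C.α g h ∈ L := by
  simp only [componentMul, spanSingleton_mul_spanSingleton, spanSingleton_mul_le_iff,
    mem_fracIdealAut, forall_exists_index, and_imp, forall_apply_eq_imp_iff₂]
  refine forall₂_congr fun y _ => ?_
  rw [mul_rotate]

theorem componentMul_spanSingleton_right_le_iff {g h : G} {y : K} {I L : FractionalIdeal R⁰ K} :
    C.componentMul g h I (spanSingleton R⁰ y) ≤ L ↔
      ∀ x ∈ I, x * fracAut R K g y * C.α g h ∈ L := by
  simp only [componentMul, fracIdealAut_spanSingleton, mul_right_comm _ I,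
    spanSingleton_mul_spanSingleton, spanSingleton_mul_le_iff]
  refine forall₂_congr fun x _ => ?_
  rw [mul_comm, mul_comm (C.α g h), mul_assoc]

/-- The valuation at `g • Q` of `∏_k α(g, k)`, which is up to sign the determinant of the
semilinear left multiplication by `u_g` on `A`. It shifts valuations to levels that are additive
under multiplication. -/
noncomputable def cocycleWeight (g : G) (Q : HeightOneSpectrum R) : ℤ :=
  ∑ k, count K (g • Q) (spanSingleton R⁰ (C.α g k))

theorem cocycleWeight_mul (g h : G) (Q : HeightOneSpectrum R) :
    Fintype.card G * count K ((g * h) • Q) (spanSingleton R⁰ (C.α g h)) +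
      C.cocycleWeight (g * h) Q = C.cocycleWeight g (h • Q) + C.cocycleWeight h Q := by
  have span_α_ne_zero (a b : G) : spanSingleton R⁰ (C.α a b) ≠ 0 :=
    spanSingleton_ne_zero_iff.2 (C.α_ne_zero a b)
  have count_α_cocycle (k : G) : count K ((g * h) • Q) (spanSingleton R⁰ (C.α g h)) +
      count K ((g * h) • Q) (spanSingleton R⁰ (C.α (g * h) k)) =
      count K (g • h • Q) (spanSingleton R⁰ (C.α g (h * k))) +
        count K (h • Q) (spanSingleton R⁰ (C.α h k)) := by
    have hσα : spanSingleton R⁰ (fracAut R K g (C.α h k)) ≠ 0 := by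
      simpa [spanSingleton_ne_zero_iff] using C.α_ne_zero h k
    have hσ := count_smul_fracIdealAut g (h • Q) (span_α_ne_zero h k)
    rw [fracIdealAut_spanSingleton] at hσ
    rw [← count_mul K _ (span_α_ne_zero _ _) (span_α_ne_zero _ _),
      spanSingleton_mul_spanSingleton, C.α_cocycle, ← spanSingleton_mul_spanSingleton,
      count_mul K _ hσα (span_α_ne_zero _ _), mul_smul, hσ, add_comm]
  calc
    _ = ∑ k, (count K ((g * h) • Q) (spanSingleton R⁰ (C.α g h)) +
        count K ((g * h) • Q) (spanSingleton R⁰ (C.α (g * h) k))) := by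
      simp [Finset.sum_add_distrib, cocycleWeight]
    _ = ∑ k, count K (g • h • Q) (spanSingleton R⁰ (C.α g (h * k))) + C.cocycleWeight h Q := by
      simp only [count_α_cocycle, Finset.sum_add_distrib, cocycleWeight]
    _ = C.cocycleWeight g (h • Q) + C.cocycleWeight h Q := by
      exact congrArg (· + _) (Equiv.sum_comp (Equiv.mulLeft h)
        fun k => count K (g • h • Q) (spanSingleton R⁰ (C.α g k)))

theorem isCocycleMod_cocycleWeight : IsCocycleMod (Fintype.card G) C.cocycleWeight := by
  intro g h Q
  rw [← cocycleWeight_mul]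
  simp [Int.ModEq]

theorem cocycleWeight_one (Q : HeightOneSpectrum R) : C.cocycleWeight 1 Q = 0 := by
  simp [cocycleWeight, α_one_left, count_one]

theorem hasFiniteSupport_cocycleWeight (g : G) : (C.cocycleWeight g).HasFiniteSupport :=
  Function.HasFiniteSupport.sum (fun _ => hasFiniteSupport_count_smul g _) Finset.univ

/-- The level of the component `I u_g` at `Q`: `|G|` times the valuation of `I` at `g • Q`,
normalised by the weight of `u_g` so that levels add up under multiplication. -/
noncomputable def componentLevel (g : G) (I : FractionalIdeal R⁰ K) (Q : HeightOneSpectrum R) : ℤ :=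
  Fintype.card G * count K (g • Q) I + C.cocycleWeight g Q

theorem componentLevel_modEq (g : G) (I : FractionalIdeal R⁰ K) (Q : HeightOneSpectrum R) :
    C.componentLevel g I Q ≡ C.cocycleWeight g Q [ZMOD Fintype.card G] := by
  simp [componentLevel, Int.ModEq]

theorem hasFiniteSupport_componentLevel (g : G) (I : FractionalIdeal R⁰ K) :
    (C.componentLevel g I).HasFiniteSupport :=
  ((hasFiniteSupport_count_smul g I).fun_comp (g := (Fintype.card G * · : ℤ → ℤ))
    (mul_zero _)).add (C.hasFiniteSupport_cocycleWeight g)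

theorem componentMul_ne_zero {g h : G} {I J : FractionalIdeal R⁰ K} (hI : I ≠ 0) (hJ : J ≠ 0) :
    C.componentMul g h I J ≠ 0 :=
  mul_ne_zero (mul_ne_zero (spanSingleton_ne_zero_iff.2 (C.α_ne_zero g h)) hI) (by simpa using hJ)

theorem componentLevel_componentMul (g h : G) (Q : HeightOneSpectrum R)
    {I J : FractionalIdeal R⁰ K} (hI : I ≠ 0) (hJ : J ≠ 0) :
    C.componentLevel (g * h) (C.componentMul g h I J) Q =
      C.componentLevel g I (h • Q) + C.componentLevel h J Q := by
  have hα : spanSingleton R⁰ (C.α g h) ≠ 0 := spanSingleton_ne_zero_iff.2 (C.α_ne_zero g h)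
  have hw := C.cocycleWeight_mul g h Q
  rw [mul_smul] at hw
  rw [componentLevel, componentMul, count_mul K _ (mul_ne_zero hα hI) (by simpa using hJ),
    count_mul K _ hα hI, componentLevel, componentLevel, mul_smul, count_smul_fracIdealAut g _ hJ]
  linear_combination hw

theorem le_iff_componentLevel_le (g : G) {I J : FractionalIdeal R⁰ K} (hI : I ≠ 0)
    (hJ : J ≠ 0) : I ≤ J ↔ C.componentLevel g J ≤ C.componentLevel g I := by
  have hcard : (0 : ℤ) < Fintype.card G := Nat.cast_pos.2 Fintype.card_pos
  rw [fractionalIdeal_le_iff_count_le hI hJ, (MulAction.surjective g).forall]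
  simp only [Pi.le_def, componentLevel, add_le_add_iff_right, mul_le_mul_iff_right₀ hcard]

theorem exists_componentLevel_eq {g : G} {d : HeightOneSpectrum R → ℤ} (hd : d.HasFiniteSupport)
    (hmod : ∀ Q, d Q ≡ C.cocycleWeight g Q [ZMOD Fintype.card G]) :
    ∃ I : FractionalIdeal R⁰ K, I ≠ 0 ∧ C.componentLevel g I = d := by
  choose e he using fun Q => (hmod Q).symm.dvd
  have he_fin : e.HasFiniteSupport :=
    (hd.sub (C.hasFiniteSupport_cocycleWeight g)).subset fun Q hQ => by
      simpa [he] using hQ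
  have hexps : ∀ᶠ P : HeightOneSpectrum R in Filter.cofinite, e (g⁻¹ • P) = 0 :=
    hasFiniteSupport_comp_smul he_fin g⁻¹
  refine ⟨∏ᶠ P : HeightOneSpectrum R, (P.asIdeal : FractionalIdeal R⁰ K) ^ e (g⁻¹ • P),
    finprod_induction (· ≠ 0) one_ne_zero (fun _ _ => mul_ne_zero) fun P =>
      zpow_ne_zero _ (coeIdeal_ne_zero.2 P.ne_bot), funext fun Q => ?_⟩
  rw [componentLevel, count_finprod K _ _ hexps, inv_smul_smul, ← he, sub_add_cancel]

theorem componentMul_le_iff_componentLevel_le {g h : G} {I J L : FractionalIdeal R⁰ K}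
    (hI : I ≠ 0) (hJ : J ≠ 0) (hL : L ≠ 0) :
    C.componentMul g h I J ≤ L ↔ ∀ Q, C.componentLevel (g * h) L Q ≤
      C.componentLevel g I (h • Q) + C.componentLevel h J Q := by
  rw [C.le_iff_componentLevel_le (g * h) (C.componentMul_ne_zero hI hJ) hL]
  simp only [Pi.le_def, C.componentLevel_componentMul g h _ hI hJ]

/-- The levels of the components of `C.gradedLattice J`. -/
noncomputable def level (J : G → FractionalIdeal R⁰ K) (g : G) (Q : HeightOneSpectrum R) : ℤ :=
  C.componentLevel g (J g) Q

theorem level_modEq (J : G → FractionalIdeal R⁰ K) (g : G) (Q : HeightOneSpectrum R) :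
    C.level J g Q ≡ C.cocycleWeight g Q [ZMOD Fintype.card G] :=
  C.componentLevel_modEq g (J g) Q

theorem exists_level_eq {d : G → HeightOneSpectrum R → ℤ} (hd : ∀ g, (d g).HasFiniteSupport)
    (hmod : ∀ g Q, d g Q ≡ C.cocycleWeight g Q [ZMOD Fintype.card G]) :
    ∃ J : G → FractionalIdeal R⁰ K, (∀ g, J g ≠ 0) ∧ C.level J = d := by
  choose J hJ hlevel using fun g => C.exists_componentLevel_eq (hd g) (hmod g)
  exact ⟨J, hJ, funext hlevel⟩

variable {C} {J J' : G → FractionalIdeal R⁰ K}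

theorem gradedLattice_le_iff_level_le (hJ : ∀ g, J g ≠ 0) (hJ' : ∀ g, J' g ≠ 0) :
    C.gradedLattice J ≤ C.gradedLattice J' ↔ C.level J' ≤ C.level J :=
  gradedLattice_le_gradedLattice_iff.trans <|
    forall_congr' fun g => C.le_iff_componentLevel_le g (hJ g) (hJ' g)

theorem mem_leftOrder_gradedLattice_iff {a : A} :
    a ∈ leftOrder (C.gradedLattice J) ↔
      ∀ g h, C.componentMul g h (spanSingleton R⁰ (C.coeff a g)) (J h) ≤ J (g * h) := by
  calc a ∈ leftOrder (C.gradedLattice J)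
      ↔ ∀ h, ∀ y ∈ J h, a * C.hom h y ∈ C.gradedLattice J :=
        gradedLattice_le_iff (D := (C.gradedLattice J).comap (AddMonoidHom.mulLeft a))
    _ ↔ ∀ h, ∀ y ∈ J h, ∀ g, C.coeff (a * C.hom h y) (g * h) ∈ J (g * h) :=
        forall_congr' fun h => forall₂_congr fun _ _ => (Group.mulRight_bijective h).2.forall
    _ ↔ _ := by
        simp only [coeff_mul_hom, componentMul_spanSingleton_left_le_iff]
        exact ⟨fun H g h y hy => H h y hy g, fun H h y hy g => H g h y hy⟩

theorem mem_rightOrder_gradedLattice_iff {a : A} :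
    a ∈ rightOrder (C.gradedLattice J) ↔
      ∀ g h, C.componentMul g h (J g) (spanSingleton R⁰ (C.coeff a h)) ≤ J (g * h) := by
  calc a ∈ rightOrder (C.gradedLattice J)
      ↔ ∀ g, ∀ x ∈ J g, C.hom g x * a ∈ C.gradedLattice J :=
        gradedLattice_le_iff (D := (C.gradedLattice J).comap (AddMonoidHom.mulRight a))
    _ ↔ ∀ g, ∀ x ∈ J g, ∀ h, C.coeff (C.hom g x * a) (g * h) ∈ J (g * h) :=
        forall_congr' fun g => forall₂_congr fun _ _ => (Group.mulLeft_bijective g).2.forall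
    _ ↔ _ := by
        simp only [coeff_hom_mul, componentMul_spanSingleton_right_le_iff]
        exact ⟨fun H g h x hx => H g x hx h, fun H g x hx h => H g h x hx⟩

theorem mem_iff_forall_componentMul_le_of_leftResidual (hJ : ∀ g, J g ≠ 0) {g : G}
    {L : FractionalIdeal R⁰ K} (hL : L ≠ 0)
    (hlevel : C.componentLevel g L = leftResidual (C.level J) g) {x : K} :
    x ∈ L ↔ ∀ h, C.componentMul g h (spanSingleton R⁰ x) (J h) ≤ J (g * h) := by
  rcases eq_or_ne x 0 with rfl | hx
  · have zero_mem : (0 : K) ∈ L := (L : Submodule R K).zero_mem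
    simp [componentMul, zero_mem]
  have hspan : spanSingleton R⁰ x ≠ 0 := spanSingleton_ne_zero_iff.2 hx
  rw [← spanSingleton_le_iff_mem, C.le_iff_componentLevel_le g hspan hL, hlevel, Pi.le_def]
  simp only [leftResidual_le_iff]
  rw [forall_comm]
  refine forall_congr' fun h => ?_
  rw [C.componentMul_le_iff_componentLevel_le hspan (hJ h) (hJ (g * h)),
    (MulAction.surjective h).forall]
  simp only [inv_smul_smul, level]

theorem mem_iff_forall_componentMul_le_of_rightResidual (hJ : ∀ g, J g ≠ 0) {h : G}
    {L : FractionalIdeal R⁰ K} (hL : L ≠ 0)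
    (hlevel : C.componentLevel h L = rightResidual (C.level J) h) {x : K} :
    x ∈ L ↔ ∀ g, C.componentMul g h (J g) (spanSingleton R⁰ x) ≤ J (g * h) := by
  rcases eq_or_ne x 0 with rfl | hx
  · have zero_mem : (0 : K) ∈ L := (L : Submodule R K).zero_mem
    simp [componentMul, zero_mem]
  have hspan : spanSingleton R⁰ x ≠ 0 := spanSingleton_ne_zero_iff.2 hx
  rw [← spanSingleton_le_iff_mem, C.le_iff_componentLevel_le h hspan hL, hlevel, Pi.le_def]
  simp only [rightResidual_le_iff]
  rw [forall_comm]
  exact forall_congr' fun g =>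
    (C.componentMul_le_iff_componentLevel_le (hJ g) hspan (hJ (g * h))).symm

variable (C) in
theorem exists_leftOrder_eq_gradedLattice (hJ : ∀ g, J g ≠ 0) :
    ∃ L : G → FractionalIdeal R⁰ K, (∀ g, L g ≠ 0) ∧ C.level L = leftResidual (C.level J) ∧
      (leftOrder (C.gradedLattice J)).toAddSubgroup = C.gradedLattice L := by
  obtain ⟨L, hL, hlevel⟩ := C.exists_level_eq
    (hasFiniteSupport_leftResidual fun g => C.hasFiniteSupport_componentLevel g (J g))
    (isOrderLevel_leftResidual C.isCocycleMod_cocycleWeight (C.level_modEq J)).modEq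
  refine ⟨L, hL, hlevel, AddSubgroup.ext fun a => mem_leftOrder_gradedLattice_iff.trans ?_⟩
  exact forall_congr' fun g => (mem_iff_forall_componentMul_le_of_leftResidual hJ (hL g)
    (congrFun hlevel g)).symm

variable (C) in
theorem exists_rightOrder_eq_gradedLattice (hJ : ∀ g, J g ≠ 0) :
    ∃ L : G → FractionalIdeal R⁰ K, (∀ g, L g ≠ 0) ∧ C.level L = rightResidual (C.level J) ∧
      (rightOrder (C.gradedLattice J)).toAddSubgroup = C.gradedLattice L := by
  obtain ⟨L, hL, hlevel⟩ := C.exists_level_eq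
    (hasFiniteSupport_rightResidual fun g => C.hasFiniteSupport_componentLevel g (J g))
    (isOrderLevel_rightResidual C.isCocycleMod_cocycleWeight (C.level_modEq J)).modEq
  refine ⟨L, hL, hlevel, AddSubgroup.ext fun a => mem_rightOrder_gradedLattice_iff.trans ?_⟩
  rw [forall_comm]
  exact forall_congr' fun h => (mem_iff_forall_componentMul_le_of_rightResidual hJ (hL h)
    (congrFun hlevel h)).symm

theorem one_mem_gradedLattice_iff (hJ : J 1 ≠ 0) :
    (1 : A) ∈ C.gradedLattice J ↔ ∀ Q, C.level J 1 Q ≤ 0 := by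
  rw [← C.hom_one_one, hom_mem_gradedLattice, ← FractionalIdeal.one_le,
    C.le_iff_componentLevel_le 1 one_ne_zero hJ, Pi.le_def]
  simp only [componentLevel, count_one, cocycleWeight_one, mul_zero, add_zero, level]

theorem gradedLattice_mul_mem_iff (hJ : ∀ g, J g ≠ 0) :
    (∀ a ∈ C.gradedLattice J, ∀ b ∈ C.gradedLattice J, a * b ∈ C.gradedLattice J) ↔
      ∀ g h Q, C.level J (g * h) Q ≤ C.level J g (h • Q) + C.level J h Q := by
  obtain ⟨L, hL, hlevel, hleft⟩ := C.exists_leftOrder_eq_gradedLattice hJ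
  calc (∀ a ∈ C.gradedLattice J, ∀ b ∈ C.gradedLattice J, a * b ∈ C.gradedLattice J)
      ↔ C.gradedLattice J ≤ (leftOrder (C.gradedLattice J)).toAddSubgroup := Iff.rfl
    _ ↔ leftResidual (C.level J) ≤ C.level J := by
        rw [hleft, gradedLattice_le_iff_level_le hJ hL, hlevel]
    _ ↔ _ := leftResidual_le_self_iff

theorem exists_subring_eq_gradedLattice_iff (hJ : ∀ g, J g ≠ 0) :
    (∃ Λ : Subring A, Λ.toAddSubgroup = C.gradedLattice J) ↔
      IsOrderLevel (Fintype.card G) C.cocycleWeight (C.level J) := by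
  constructor
  · rintro ⟨Λ, hΛ⟩
    refine ⟨C.level_modEq J, (gradedLattice_mul_mem_iff hJ).1 ?_,
      (one_mem_gradedLattice_iff (hJ 1)).1 ?_⟩ <;> rw [← hΛ]
    · exact fun _ ha _ hb => Λ.mul_mem ha hb
    · exact Λ.one_mem
  · intro hc
    exact ⟨{ C.gradedLattice J with
      mul_mem' := fun ha hb => (gradedLattice_mul_mem_iff hJ).2 hc.mul_le _ ha _ hb
      one_mem' := (one_mem_gradedLattice_iff (hJ 1)).2 hc.one_le }, rfl⟩

theorem isGrOrder_of_eq_gradedLattice {Λ : Subring A} (hJ : ∀ g, J g ≠ 0)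
    (hΛ : Λ.toAddSubgroup = C.gradedLattice J) : C.IsGrOrder Λ where
  isFullLattice := by
    rw [hΛ]
    exact isFullLattice_gradedLattice hJ
  isGraded := by
    rw [← Subring.coe_toAddSubgroup, hΛ]
    exact isGraded_gradedLattice

theorem le_iff_level_le {Λ Λ' : Subring A} (hJ : ∀ g, J g ≠ 0) (hJ' : ∀ g, J' g ≠ 0)
    (hΛ : Λ.toAddSubgroup = C.gradedLattice J) (hΛ' : Λ'.toAddSubgroup = C.gradedLattice J') :
    Λ ≤ Λ' ↔ C.level J' ≤ C.level J := by
  rw [← gradedLattice_le_iff_level_le hJ hJ', ← hΛ, ← hΛ']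
  rfl

theorem isGrMaximalOrder_iff_minimal {Λ : Subring A} (hJ : ∀ g, J g ≠ 0)
    (hΛ : Λ.toAddSubgroup = C.gradedLattice J) :
    C.IsGrMaximalOrder Λ ↔
      Minimal (IsOrderLevel (Fintype.card G) C.cocycleWeight) (C.level J) := by
  have hlevel := (exists_subring_eq_gradedLattice_iff hJ).1 ⟨Λ, hΛ⟩
  constructor
  · refine fun hmax => ⟨hlevel, fun c hc hcJ => ?_⟩
    have hcfin (g : G) : (c g).HasFiniteSupport :=
      hc.hasFiniteSupport_of_le hcJ (fun g => C.hasFiniteSupport_componentLevel g (J g)) g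
    obtain ⟨L, hL, rfl⟩ := C.exists_level_eq hcfin hc.modEq
    obtain ⟨Λ', hΛ'⟩ := (exists_subring_eq_gradedLattice_iff hL).2 hc
    rw [← le_iff_level_le hL hJ hΛ' hΛ]
    exact hmax.2 (isGrOrder_of_eq_gradedLattice hL hΛ') ((le_iff_level_le hJ hL hΛ hΛ').2 hcJ)
  · refine fun hmin => ⟨isGrOrder_of_eq_gradedLattice hJ hΛ, fun Λ' hord hle => ?_⟩
    obtain ⟨L, hL, hΛ'⟩ := hord.exists_eq_gradedLattice
    rw [le_iff_level_le hL hJ hΛ' hΛ]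
    exact hmin.2 ((exists_subring_eq_gradedLattice_iff hL).1 ⟨Λ', hΛ'⟩)
      ((le_iff_level_le hJ hL hΛ hΛ').1 hle)

end Level

end CrystallineGraded

theorem mainTheorem12 {R K G A : Type*} [CommRing R] [IsDedekindDomain R] [Field K]
    [Algebra R K] [IsFractionRing R K] [Group G] [Fintype G] [MulSemiringAction G R] [Ring A]
    (C : CrystallineGraded R K G A) (M : AddSubgroup A)
    (hM : C.IsFullLattice M) (hgr : C.IsGraded (M : Set A)) :
    C.IsGrMaximalOrder (leftOrder M) ↔ C.IsGrMaximalOrder (rightOrder M) := by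
  obtain ⟨J, hJ, rfl⟩ := hM.exists_eq_gradedLattice hgr
  obtain ⟨L, hL, hlevelL, hleft⟩ := C.exists_leftOrder_eq_gradedLattice hJ
  obtain ⟨L', hL', hlevelL', hright⟩ := C.exists_rightOrder_eq_gradedLattice hJ
  rw [CrystallineGraded.isGrMaximalOrder_iff_minimal hL hleft, hlevelL,
    CrystallineGraded.isGrMaximalOrder_iff_minimal hL' hright, hlevelL']
  exact minimal_leftResidual_iff_minimal_rightResidual (Nat.cast_pos.2 Fintype.card_pos)
    C.isCocycleMod_cocycleWeight (C.level_modEq J)
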